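/- Let $d\ge 0$ and let $A\subset\mathbb{Z}^d$ be a finite set which generates $\mathbb{Z}^d$ as an abelian group. Let $\mathbb{N}A\subseteq\mathbb{Z}^d$ be the submonoid generated by $A$, let $R_A=\mathbb{C}[\mathbb{N}A]$ be its semigroup algebra, and let $D(R_A)=\bigcup_{k\ge 0}D^k(R_A)\subseteq\mathrm{End}_{\mathbb{C}}(R_A)$ be the ring of $\mathbb{C}$-linear differential operators on $R_A$, where $D^0(R_A)=\mathrm{End}_{R_A}(R_A)$ and $D^{k+1}(R_A)=\{P\in \mathrm{End}_{\mathbb{C}}(R_A) : [f,P]\in D^k(R_A)\text{ for all } f\in R_A\}$. Let $\mathcal{F}$ be the set of facets (maximal proper faces) of the cone $\mathbb{R}_{\ge 0}A\subseteq\mathbb{R}^d$, and for $\sigma\in\mathcal{F}$ let $F_\sigma$ be its primitive integral support function, i.e. the unique linear form on $\mathbb{R}^d$ with $F_\sigma(\mathbb{R}_{\ge 0}A)\ge 0$, $F_\sigma(\sigma)=0$ and $F_\sigma(\mathbb{Z}^d)=\mathbb{Z}$. The semigroup $\mathbb{N}A$ is called scored if $$\mathbb{N}A=\bigcap_{\sigma\in\mathcal{F}}\{a\in\mathbb{Z}^d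 : F_\sigma(a)\in F_\sigma(\mathbb{N}A)\}.$$ If $D(R_A)$ is a simple ring (that is, it is nonzero and its only two-sided ideals are $0$ and itself), then $\mathbb{N}A$ is scored. -/

import Mathlib

namespace ToricDiffOp

section DiffOp

variable {K S M : Type*} [CommRing K] [CommRing S] [Algebra K S] [AddCommGroup M] [Module K M]
  [Module S M] [IsScalarTower K S M]

variable (S) in
/-- The commutator `[f, P] = f ∘ P - P ∘ f` of multiplication by `f : S` with a `K`-linear
endomorphism `P` of the `S`-module `M`. -/
def opComm (f : S) (P : Module.End K M) : Module.End K M :=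
  Algebra.lsmul K K M f * P - P * Algebra.lsmul K K M f

variable (S) in
/-- `P` is a `K`-linear differential operator of order at most `k` on the `S`-module `M`:
`P` is `S`-linear if `k = 0`, and `[f, P]` has order at most `k - 1` for all `f : S` otherwise. -/
def IsDiffOp : ℕ → Module.End K M → Prop
  | 0, P => ∀ (f : S) (m : M), P (f • m) = f • P m
  | k + 1, P => ∀ f : S, IsDiffOp k (opComm S f P)

theorem isDiffOp_zero_iff {P : Module.End K M} : IsDiffOp S 0 P ↔ ∀ f : S, opComm S f P = 0 := by
  constructor
  · intro h f
    ext m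
    simp [opComm, h f m]
  · intro h f m
    have := LinearMap.congr_fun (h f) m
    simp only [opComm, LinearMap.sub_apply, Module.End.mul_apply, Algebra.lsmul_coe,
      LinearMap.zero_apply] at this
    exact (sub_eq_zero.mp this).symm

theorem IsDiffOp.zero (k : ℕ) : IsDiffOp S k (0 : Module.End K M) := by
  induction k with
  | zero => intro f m; simp
  | succ k ih => intro f; simpa [opComm] using ih

theorem IsDiffOp.succ {k : ℕ} {P : Module.End K M} (h : IsDiffOp S k P) :
    IsDiffOp S (k + 1) P := by
  induction k generalizing P with
  | zero =>
    intro f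
    rw [isDiffOp_zero_iff.mp h f]
    exact .zero 0
  | succ k ih => intro f; exact ih (h f)

theorem IsDiffOp.mono {k l : ℕ} {P : Module.End K M} (hkl : k ≤ l) (h : IsDiffOp S k P) :
    IsDiffOp S l P := by
  induction hkl with
  | refl => exact h
  | step _ ih => exact ih.succ

theorem IsDiffOp.add {k : ℕ} {P Q : Module.End K M} (hP : IsDiffOp S k P)
    (hQ : IsDiffOp S k Q) : IsDiffOp S k (P + Q) := by
  induction k generalizing P Q with
  | zero => intro f m; simp [hP f m, hQ f m]
  | succ k ih =>
    intro f
    have : opComm S f (P + Q) = opComm S f P + opComm S f Q := by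
      simp only [opComm, mul_add, add_mul]; abel
    rw [this]
    exact ih (hP f) (hQ f)

theorem opComm_mul (f : S) (P Q : Module.End K M) :
    opComm S f (P * Q) = opComm S f P * Q + P * opComm S f Q := by
  simp only [opComm, sub_mul, mul_sub, mul_assoc]; abel

theorem IsDiffOp.mul {k l : ℕ} {P Q : Module.End K M} (hP : IsDiffOp S k P)
    (hQ : IsDiffOp S l Q) : IsDiffOp S (k + l) (P * Q) := by
  induction hn : k + l generalizing k l P Q with
  | zero =>
    obtain ⟨rfl, rfl⟩ : k = 0 ∧ l = 0 := by omega
    intro f m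
    simp [hQ f m, hP f (Q m)]
  | succ n ih =>
    intro f
    rw [opComm_mul]
    refine IsDiffOp.add ?_ ?_
    · cases k with
      | zero => rw [isDiffOp_zero_iff.mp hP f, zero_mul]; exact .zero n
      | succ k => exact ih (hP f) hQ (by omega)
    · cases l with
      | zero => rw [isDiffOp_zero_iff.mp hQ f, mul_zero]; exact .zero n
      | succ l => exact ih hP (hQ f) (by omega)

variable (K S M) in
/-- The `K`-algebra `D(M) = ⋃ₖ Dᵏ(M)` of differential operators on the `S`-module `M`. -/
def diffOps : Subalgebra K (Module.End K M) where
  carrier := {P | ∃ k, IsDiffOp S k P}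
  mul_mem' := by
    rintro P Q ⟨k, hP⟩ ⟨l, hQ⟩
    exact ⟨k + l, hP.mul hQ⟩
  add_mem' := by
    rintro P Q ⟨k, hP⟩ ⟨l, hQ⟩
    exact ⟨max k l, (hP.mono (le_max_left k l)).add (hQ.mono (le_max_right k l))⟩
  algebraMap_mem' r := by
    refine ⟨0, fun f m => ?_⟩
    rw [Module.algebraMap_end_apply, Module.algebraMap_end_apply, ← algebraMap_smul S r (f • m),
      ← algebraMap_smul S r m, smul_comm]

end DiffOp

section Semigroup

variable {d : ℕ}

/-- The submonoid `ℕA` of `ℤᵈ` generated by `A`. -/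
def semigroup (A : Finset (Fin d → ℤ)) : AddSubmonoid (Fin d → ℤ) :=
  AddSubmonoid.closure (A : Set (Fin d → ℤ))

/-- The semigroup algebra `R_A = ℂ[ℕA]`. -/
abbrev SemigroupRing (A : Finset (Fin d → ℤ)) : Type :=
  AddMonoidAlgebra ℂ (semigroup A)

/-- The ring `D(R_A)` of `ℂ`-linear differential operators on `R_A`. -/
noncomputable abbrev diffOpRing (A : Finset (Fin d → ℤ)) :
    Subalgebra ℂ (Module.End ℂ (SemigroupRing A)) :=
  diffOps ℂ (SemigroupRing A) (SemigroupRing A)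

/-- The inclusion of `ℤᵈ` into `ℝᵈ`. -/
def toReal (a : Fin d → ℤ) : Fin d → ℝ := fun i => (a i : ℝ)

/-- The cone `ℝ_{≥0}A` generated by `A` in `ℝᵈ`. -/
def cone (A : Finset (Fin d → ℤ)) : PointedCone ℝ (Fin d → ℝ) :=
  PointedCone.hull ℝ (toReal '' (A : Set (Fin d → ℤ)))

/-- A facet of the cone `C` is a maximal proper face of `C`. -/
def IsFacet (σ C : PointedCone ℝ (Fin d → ℝ)) : Prop :=
  Maximal (fun τ : PointedCone ℝ (Fin d → ℝ) => τ.IsFaceOf C ∧ τ ≠ C) σ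

/-- `F` is the primitive integral support function of the facet `σ` of `C`: the linear form on
`ℝᵈ` with `F(C) ≥ 0`, `F(σ) = 0` and `F(ℤᵈ) = ℤ`. -/
structure IsPrimitiveSupport (C σ : PointedCone ℝ (Fin d → ℝ))
    (F : (Fin d → ℝ) →ₗ[ℝ] ℝ) : Prop where
  nonneg : ∀ x ∈ C, 0 ≤ F x
  eq_zero : ∀ x ∈ σ, F x = 0
  image_int : Set.range (fun a : Fin d → ℤ => F (toReal a)) = Set.range (fun m : ℤ => (m : ℝ))

/-- `ℕA` is scored: it is the intersection, over all facets `σ` of `ℝ_{≥0}A` with primitive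
integral support function `F`, of the sets `{a ∈ ℤᵈ | F(a) ∈ F(ℕA)}`. -/
def IsScored (A : Finset (Fin d → ℤ)) : Prop :=
  (semigroup A : Set (Fin d → ℤ)) =
    {a | ∀ σ : PointedCone ℝ (Fin d → ℝ), IsFacet σ (cone A) →
      ∀ F : (Fin d → ℝ) →ₗ[ℝ] ℝ, IsPrimitiveSupport (cone A) σ F →
        F (toReal a) ∈ (fun b => F (toReal b)) '' (semigroup A : Set (Fin d → ℤ))}

end Semigroup

end ToricDiffOp

namespace ToricDiffOp

/-! ### Extending differential operators along a localisation -/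

section Extension

variable {K S M : Type*} [CommRing K] [CommRing S] [Algebra K S] [AddCommGroup M] [Module K M]
  [Module S M] [IsScalarTower K S M]

/-! Write `S_c` for the scored closure of `ℕA`. Each operator in `D(R_A)` extends uniquely to the
Laurent ring (`IsDiffOp.exists_extension`, `diffOps_eq_of_forall_algebraMap`), and the extension
preserves `ℂ[S_c]` (`map_supported_scoredClosure`). Hence the operators whose extension maps
`ℂ[S_c]` into `ℂ[ℕA]` form a two-sided ideal. It is nonzero, since `S_c` lies in the cone and some
translate `c + (cone ∩ ℤᵈ)` lies in `ℕA` (`exists_conductor`). By simplicity it contains the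
identity, so `S_c ⊆ ℕA`.

Preservation is the crux. Let `s ∈ S_c` and `g ∉ S_c`, so `F(g) ∉ F(ℕA)` for some facet form `F`,
and pick `b ∈ ℕA` with `F(b) = F(s)`. The coefficient of the operator in degree shift `g - s` is a
polynomial function of the exponent. It vanishes on `b + N`, with `N` generated by the elements of
`A` on the facet, because the target exponent still has `F`-value `F(g)`. As `N` generates the
kernel of `F` up to finite index, it also vanishes at `s`. -/

theorem opComm_apply (f : S) (P : Module.End K M) (m : M) :
    opComm S f P m = f • P m - P (f • m) := by
  simp [opComm]

theorem isDiffOp_opComm {k : ℕ} {P : Module.End K M} (hP : IsDiffOp S k P) (f : S) :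
    IsDiffOp S k (opComm S f P) :=
  hP.succ f

variable {R L : Type*} [CommRing R] [CommRing L] [Algebra K R] [Algebra K L] [Algebra R L]
  [IsScalarTower K R L]

/-- By induction the commutators of `Q` vanish, so `Q` is `R`-linear; then `w • Q y = Q (w • y) = 0`
with `w` a unit of `L`. -/
theorem IsDiffOp.eq_zero_of_forall_algebraMap
    (hden : ∀ y : L, ∃ w r : R, IsUnit (algebraMap R L w) ∧ w • y = algebraMap R L r)
    {k : ℕ} {Q : Module.End K L} (hQ : IsDiffOp R k Q)
    (h : ∀ x : R, Q (algebraMap R L x) = 0) : Q = 0 := by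
  have main : ∀ Q : Module.End K L, IsDiffOp R 0 Q → (∀ x : R, Q (algebraMap R L x) = 0) →
      Q = 0 := by
    intro Q hQ h
    ext y
    obtain ⟨w, r, hw, hr⟩ := hden y
    have h1 := hQ w y
    rw [hr, h, Algebra.smul_def] at h1
    exact hw.mul_right_eq_zero.mp h1.symm
  induction k generalizing Q with
  | zero => exact main Q hQ h
  | succ k ih =>
    refine main Q (isDiffOp_zero_iff.mpr fun f => ih (hQ f) fun x => ?_) h
    rw [opComm_apply, h, ← algebraMap_smul L f (algebraMap R L x), smul_eq_mul, ← map_mul, h,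
      smul_zero, sub_zero]

theorem diffOps_eq_of_forall_algebraMap
    (hden : ∀ y : L, ∃ w r : R, IsUnit (algebraMap R L w) ∧ w • y = algebraMap R L r)
    {Q Q' : Module.End K L} (hQ : Q ∈ diffOps K R L) (hQ' : Q' ∈ diffOps K R L)
    (h : ∀ x : R, Q (algebraMap R L x) = Q' (algebraMap R L x)) : Q = Q' := by
  obtain ⟨k, hk⟩ := sub_mem hQ hQ'
  exact sub_eq_zero.mp (hk.eq_zero_of_forall_algebraMap hden fun x => by simp [h x])

/-- By induction each `[f, P]` has an extension `E f`. Requiring `[w, Q] = E w` leaves no choice for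
`Q`: if `w • y` comes from `r`, then `w • Q y = P r + E w y`. -/
theorem IsDiffOp.exists_extension (hinj : Function.Injective (algebraMap R L))
    (hden : ∀ y : L, ∃ w r : R, IsUnit (algebraMap R L w) ∧ w • y = algebraMap R L r)
    {k : ℕ} {P : Module.End K R} (hP : IsDiffOp R k P) :
    ∃ Q : Module.End K L, IsDiffOp R k Q ∧
      ∀ x : R, Q (algebraMap R L x) = algebraMap R L (P x) := by
  have hsmul : ∀ (f : R) (x : R), f • algebraMap R L x = algebraMap R L (f * x) := fun f x => by
    rw [Algebra.smul_def, map_mul]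
  have hK : ∀ (c : K) (x : R), algebraMap R L (c • x) = c • algebraMap R L x := fun c x => by
    rw [Algebra.smul_def, map_mul, ← IsScalarTower.algebraMap_apply, Algebra.smul_def]
  induction k generalizing P with
  | zero =>
    refine ⟨Algebra.lsmul K K L (P 1), fun f m => ?_, fun x => ?_⟩
    · simp only [Algebra.lsmul_coe]
      exact smul_comm _ _ _
    · have := hP x 1
      rw [smul_eq_mul, mul_one] at this
      rw [this, smul_eq_mul, mul_comm, ← hsmul]
      rfl
  | succ k ih =>
    choose E hE hEP using fun f : R => ih (hP f)
    -- Compatibility of the `E f`: on `R` this is `[v, [w, P]] = [w, [v, P]]`, and uniqueness of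
    -- extensions carries it to `L`.
    have hsymm : ∀ v w : R, opComm R v (E w) = opComm R w (E v) := by
      intro v w
      refine diffOps_eq_of_forall_algebraMap hden ⟨k, isDiffOp_opComm (hE w) v⟩ ⟨k, isDiffOp_opComm (hE v) w⟩
        fun x => ?_
      simp only [opComm_apply, hsmul, hEP, smul_eq_mul, ← map_sub]
      congr 1
      simp only [mul_sub, mul_left_comm v w]
      ring
    choose w r hw hr using hden
    choose u hu using fun y => (hw y).exists_left_inv
    let q : L → L := fun y => u y * (algebraMap R L (P (r y)) + E (w y) y)
    have hq0 : ∀ y, w y • q y = algebraMap R L (P (r y)) + E (w y) y := fun y => by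
      rw [Algebra.smul_def, ← mul_assoc, mul_comm _ (u y), hu, one_mul]
    have hcancel : ∀ y {a b : L}, w y • a = w y • b → a = b := fun y a b h => by
      rw [Algebra.smul_def, Algebra.smul_def] at h
      exact (hw y).mul_left_cancel h
    have hE' : ∀ v x, v • algebraMap R L (P x) =
        algebraMap R L (P (v * x)) + E v (algebraMap R L x) := fun v x => by
      rw [hEP, opComm_apply, hsmul, ← map_add, smul_eq_mul, smul_eq_mul]
      congr 1
      ring
    -- The defining relation holds for every denominator `v`, not only the chosen `w y`; linearity
    -- of `q` follows by taking common denominators.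
    have hq : ∀ v s y, v • y = algebraMap R L s → v • q y = algebraMap R L (P s) + E v y := by
      intro v s y h
      apply hcancel y
      have h1 : v * r y = w y * s := by
        apply hinj
        rw [← hsmul, ← hsmul, ← hr, ← h, smul_comm]
      have h2 := LinearMap.congr_fun (hsymm v (w y)) y
      rw [opComm_apply, opComm_apply] at h2
      rw [smul_comm, hq0, smul_add, smul_add, hE', hE', h1, ← hr, ← h, add_assoc, add_assoc]
      congr 1
      linear_combination h2
    let Q : Module.End K L :=
      { toFun := q
        map_add' := fun y z => by
          apply hcancel y
          apply hcancel z
          rw [smul_smul, smul_smul]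
          have hy : (w z * w y) • y = algebraMap R L (w z * r y) := by
            rw [mul_smul, hr, hsmul]
          have hz : (w z * w y) • z = algebraMap R L (w y * r z) := by
            rw [mul_comm, mul_smul, hr, hsmul]
          rw [smul_add, hq _ _ _ hy, hq _ _ _ hz,
            hq _ (w z * r y + w y * r z) _ (by rw [smul_add, hy, hz, map_add])]
          simp only [map_add]
          abel
        map_smul' := fun c y => by
          apply hcancel y
          rw [hq (w y) (c • r y) _ (by rw [smul_comm, hr, hK]), RingHom.id_apply, smul_comm, hq0]
          simp only [map_smul, hK, smul_add] }
    refine ⟨Q, fun f => ?_, fun x => ?_⟩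
    · have : opComm R f Q = E f := by
        ext y
        rw [opComm_apply]
        change f • q y - q (f • y) = _
        apply hcancel y
        rw [smul_sub, smul_comm, hq0, hq (w y) (f * r y) _ (by rw [smul_comm, hr, hsmul]),
          smul_add, hE']
        have h2 := LinearMap.congr_fun (hsymm f (w y)) y
        rw [opComm_apply, opComm_apply, hr] at h2
        linear_combination h2
      rw [this]
      exact hE f
    · have h := hq 1 x (algebraMap R L x) (one_smul _ _)
      rw [one_smul, hEP] at h
      change q _ = _
      rw [h, opComm_apply]
      simp

end Extension

/-! ### Polynomial functions on abelian groups -/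

section Polynomial

variable {G H : Type*} [AddCommGroup G] [AddCommGroup H]

/-- `f` is a polynomial function of degree at most `k` in the sense of Fréchet: all its iterated
differences of order `k + 1` vanish. -/
def IsPolyFn : ℕ → (G → ℂ) → Prop
  | 0, f => ∀ c b, f (b + c) = f b
  | k + 1, f => ∀ c, IsPolyFn k fun b => f (b + c) - f b

theorem IsPolyFn.sub {k : ℕ} {f g : G → ℂ} (hf : IsPolyFn k f) (hg : IsPolyFn k g) :
    IsPolyFn k fun b => f b - g b := by
  induction k generalizing f g with
  | zero => intro c b; simp only [hf c b, hg c b]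
  | succ k ih =>
    intro c
    convert ih (hf c) (hg c) using 2
    ring

theorem IsPolyFn.comp {k : ℕ} {f : G → ℂ} (hf : IsPolyFn k f) (φ : H →+ G) (a : G) :
    IsPolyFn k fun b => f (a + φ b) := by
  induction k generalizing f with
  | zero => intro c b; simp only [map_add, ← add_assoc, hf (φ c)]
  | succ k ih =>
    intro c
    simpa only [map_add, ← add_assoc] using ih (hf (φ c))

theorem IsPolyFn.eq_of_periodic {k : ℕ} {h : ℤ → ℂ} (hh : IsPolyFn k h) {N : ℤ} (hN : N ≠ 0)
    (hper : ∀ n, h (n + N) = h n) (n : ℤ) : h n = h 0 := by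
  induction k generalizing h n with
  | zero => simpa using hh n 0
  | succ k ih =>
    -- The first difference is periodic of lower degree, hence constant; so `h` is affine, and
    -- periodicity kills its slope.
    have h1 : ∀ m, h (m + 1) - h m = h 1 - h 0 := fun m => by
      simpa using ih (hh 1) (fun m => by rw [add_right_comm, hper, hper]) m
    have h2 : ∀ m : ℤ, h m = h 0 + m * (h 1 - h 0) := by
      intro m
      induction m with
      | zero => simp
      | succ m ihm => push_cast at ihm ⊢; linear_combination h1 m + ihm
      | pred m ihm =>
        have := h1 (-m - 1)
        rw [sub_add_cancel] at this
        push_cast at ihm ⊢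
        linear_combination ihm - this
    have h3 : h 1 - h 0 = 0 := by
      have h4 := hper 0
      rw [zero_add, h2 N] at h4
      have h5 : (N : ℂ) * (h 1 - h 0) = 0 := by linear_combination h4
      exact (mul_eq_zero.mp h5).resolve_left (by exact_mod_cast hN)
    rw [h2 n, h3]
    simp

/-- A polynomial function vanishing on `b + N`, for a submonoid `N`, vanishes at `b + v` whenever
a nonzero multiple of `v` lies in the group generated by `N`. -/
theorem IsPolyFn.eq_zero_of_smul_mem_closure {k : ℕ} {f : G → ℂ} (hf : IsPolyFn k f)
    {N : AddSubmonoid G} {b : G} (hz : ∀ n ∈ N, f (b + n) = 0) {m : ℤ} (hm : m ≠ 0) {v : G}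
    (hv : m • v ∈ AddSubgroup.closure (N : Set G)) : f (b + v) = 0 := by
  suffices H : ∀ v, (∃ m : ℤ, m ≠ 0 ∧ m • v ∈ AddSubgroup.closure (N : Set G)) → f (b + v) = 0 from
    H v ⟨m, hm, hv⟩
  clear hv hm m v
  induction k generalizing f with
  | zero =>
    intro v _
    rw [hf v b, ← hf 0 b]
    exact hz 0 N.zero_mem
  | succ k ih =>
    rintro v ⟨m, hm, hv⟩
    let V : AddSubgroup G :=
      { carrier := {v | ∃ m : ℤ, m ≠ 0 ∧ m • v ∈ AddSubgroup.closure (N : Set G)}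
        zero_mem' := ⟨1, one_ne_zero, by simp⟩
        add_mem' := by
          rintro x y ⟨p, hp, hx⟩ ⟨q, hq, hy⟩
          refine ⟨p * q, mul_ne_zero hp hq, ?_⟩
          rw [smul_add, mul_comm, mul_smul, mul_comm, mul_smul]
          exact add_mem (zsmul_mem hx q) (zsmul_mem hy p)
        neg_mem' := by
          rintro x ⟨p, hp, hx⟩
          exact ⟨p, hp, by rw [smul_neg]; exact neg_mem hx⟩ }
    have hNV : AddSubgroup.closure (N : Set G) ≤ V := fun x hx => ⟨1, one_ne_zero, by simpa⟩
    -- For `c ∈ N` the difference of `f` along `c` has lower degree and vanishes on `b + N`, so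
    -- induction applies on `b + V`. Then `f` is periodic along `ℤ v`, hence constant there.
    have hper : ∀ c ∈ AddSubgroup.closure (N : Set G), ∀ x ∈ V, f (b + x + c) = f (b + x) := by
      intro c hc
      induction hc using AddSubgroup.closure_induction with
      | mem c hc =>
        intro x hx
        refine sub_eq_zero.mp (ih (hf c) (fun n hn => ?_) x hx)
        rw [add_assoc, hz n hn, hz _ (add_mem hn hc), sub_zero]
      | zero => simp
      | add c c' hc hc' h h' =>
        intro x hx
        rw [← add_assoc, add_assoc b x c, h' _ (add_mem hx (hNV hc)), ← add_assoc, h x hx]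
      | neg c hc h =>
        intro x hx
        have := h (x - c) (sub_mem hx (hNV hc))
        rw [add_assoc, sub_add_cancel] at this
        rw [this, add_assoc, sub_eq_add_neg]
    have h1 := (hf.comp (zmultiplesHom G v) b).eq_of_periodic hm (fun n => by
      simp only [zmultiplesHom_apply, add_smul, ← add_assoc]
      exact hper _ hv _ (zsmul_mem (show v ∈ V from ⟨m, hm, hv⟩) n)) 1
    simp only [zmultiplesHom_apply, one_smul, zero_smul] at h1
    rw [h1]
    exact hz 0 N.zero_mem

end Polynomial

/-! ### Linear inequalities for finitely generated cones -/

section Farkas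

variable {E : Type*} [AddCommGroup E] [Module ℝ E]

/-- Fourier-Motzkin elimination: adding a generator to a cone cut out by finitely many linear
inequalities yields such a cone. -/
theorem exists_finset_forall_nonneg_iff_exists_sub_smul (T : Finset (E →ₗ[ℝ] ℝ)) (a : E) :
    ∃ T' : Finset (E →ₗ[ℝ] ℝ), ∀ x,
      (∃ t : ℝ, 0 ≤ t ∧ ∀ f ∈ T, 0 ≤ f (x - t • a)) ↔ ∀ f ∈ T', 0 ≤ f x := by
  classical
  refine ⟨T.filter (fun f => 0 ≤ f a) ∪ Finset.image₂ (fun f g => f a • g - g a • f)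
    (T.filter fun f => 0 < f a) (T.filter fun f => f a < 0), fun x => ⟨?_, fun h => ?_⟩⟩
  · rintro ⟨t, ht, hT⟩ f hf
    simp only [map_sub, map_smul, smul_eq_mul] at hT
    rcases Finset.mem_union.mp hf with hf | hf
    · obtain ⟨hf, hfa⟩ := Finset.mem_filter.mp hf
      have := hT f hf
      have := mul_nonneg ht hfa
      linarith
    · obtain ⟨f, hf', g, hg, rfl⟩ := Finset.mem_image₂.mp hf
      obtain ⟨hf', hfa⟩ := Finset.mem_filter.mp hf'
      obtain ⟨hg, hga⟩ := Finset.mem_filter.mp hg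
      have h1 := mul_nonneg hfa.le (hT g hg)
      have h2 := mul_nonneg (neg_nonneg.mpr hga.le) (hT f hf')
      simp only [LinearMap.sub_apply, LinearMap.smul_apply, smul_eq_mul]
      linarith
  -- The lower bounds on `t`; the largest one serves as `t`, and the combined inequalities place it
  -- below every upper bound.
  · let lo : Finset ℝ := insert 0 ((T.filter fun f => f a < 0).image fun f => f x / f a)
    have hne : lo.Nonempty := Finset.insert_nonempty _ _
    refine ⟨lo.max' hne, lo.le_max' 0 (Finset.mem_insert_self _ _), fun f hf => ?_⟩
    rw [map_sub, map_smul, smul_eq_mul, sub_nonneg]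
    rcases lt_trichotomy (f a) 0 with hfa | hfa | hfa
    · have h1 : f x / f a ≤ lo.max' hne := lo.le_max' _ <| Finset.mem_insert_of_mem <|
        Finset.mem_image.mpr ⟨f, Finset.mem_filter.mpr ⟨hf, hfa⟩, rfl⟩
      rwa [div_le_iff_of_neg hfa] at h1
    · rw [hfa, mul_zero]
      exact h f (Finset.mem_union_left _ (Finset.mem_filter.mpr ⟨hf, hfa.ge⟩))
    · rw [← le_div_iff₀ hfa]
      refine Finset.max'_le _ _ _ fun s hs => ?_
      rcases Finset.mem_insert.mp hs with rfl | hs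
      · exact div_nonneg (h f (Finset.mem_union_left _ (Finset.mem_filter.mpr ⟨hf, hfa.le⟩))) hfa.le
      · obtain ⟨g, hg, rfl⟩ := Finset.mem_image.mp hs
        have h1 := h _ (Finset.mem_union_right _ (Finset.mem_image₂_of_mem
          (Finset.mem_filter.mpr ⟨hf, hfa⟩) hg))
        have hga := (Finset.mem_filter.mp hg).2
        simp only [LinearMap.sub_apply, LinearMap.smul_apply, smul_eq_mul] at h1
        rw [div_le_iff_of_neg hga, div_mul_eq_mul_div, div_le_iff₀ hfa]
        linarith

/-- A finitely generated cone in a finite-dimensional space is cut out by finitely many linear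
inequalities. -/
theorem exists_finset_mem_hull_iff [FiniteDimensional ℝ E] (s : Finset E) :
    ∃ T : Finset (E →ₗ[ℝ] ℝ), ∀ x, x ∈ PointedCone.hull ℝ (s : Set E) ↔ ∀ f ∈ T, 0 ≤ f x := by
  classical
  induction s using Finset.induction_on with
  | empty =>
    let b := Module.finBasis ℝ E
    refine ⟨Finset.univ.image b.coord ∪ Finset.univ.image fun i => -b.coord i, fun x => ?_⟩
    have h0 : x ∈ PointedCone.hull ℝ ((∅ : Finset E) : Set E) ↔ x = 0 := by
      simp [PointedCone.hull]
    rw [h0]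
    refine ⟨fun h => by simp [h], fun h => b.ext_elem fun i => ?_⟩
    have h1 := h _ (Finset.mem_union_left _ (Finset.mem_image_of_mem _ (Finset.mem_univ i)))
    have h2 := h _ (Finset.mem_union_right _
      (Finset.mem_image_of_mem (fun i => -b.coord i) (Finset.mem_univ i)))
    simp only [LinearMap.neg_apply, Module.Basis.coord_apply] at h1 h2
    simp only [map_zero, Finsupp.coe_zero, Pi.zero_apply]
    linarith
  | insert a s _ ih =>
    obtain ⟨T, hT⟩ := ih
    obtain ⟨T', hT'⟩ := exists_finset_forall_nonneg_iff_exists_sub_smul T a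
    refine ⟨T', fun x => ?_⟩
    rw [← hT' x, Finset.coe_insert, PointedCone.hull, Submodule.mem_span_insert]
    constructor
    · rintro ⟨t, z, hz, rfl⟩
      refine ⟨t, t.2, (hT _).mp ?_⟩
      rw [show t • a = (t : ℝ) • a from rfl, add_sub_cancel_left]
      exact hz
    · rintro ⟨t, ht, h⟩
      exact ⟨⟨t, ht⟩, x - t • a, (hT _).mpr h, by
        rw [show (⟨t, ht⟩ : {c : ℝ // 0 ≤ c}) • a = t • a from rfl, add_sub_cancel]⟩

theorem exists_neg_of_notMem_hull [FiniteDimensional ℝ E] {s : Set E} (hs : s.Finite) {x : E}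
    (hx : x ∉ PointedCone.hull ℝ s) : ∃ f : E →ₗ[ℝ] ℝ, (∀ a ∈ s, 0 ≤ f a) ∧ f x < 0 := by
  obtain ⟨T, hT⟩ := exists_finset_mem_hull_iff hs.toFinset
  rw [hs.coe_toFinset] at hT
  rw [hT] at hx
  push Not at hx
  obtain ⟨f, hf, hfx⟩ := hx
  exact ⟨f, fun a ha => (hT a).mp (Submodule.subset_span ha) f hf, hfx⟩

end Farkas

/-! ### Facets and their primitive support functions -/

section Cone

variable {d : ℕ}

/-- The inclusion of `ℤᵈ` into `ℝᵈ` as a homomorphism. -/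
def toRealHom (d : ℕ) : (Fin d → ℤ) →+ (Fin d → ℝ) where
  toFun := toReal
  map_zero' := by ext; simp [toReal]
  map_add' _ _ := by ext; simp [toReal]

theorem toReal_add (a b : Fin d → ℤ) : toReal (a + b) = toReal a + toReal b :=
  map_add (toRealHom d) a b

theorem toReal_sub (a b : Fin d → ℤ) : toReal (a - b) = toReal a - toReal b :=
  map_sub (toRealHom d) a b

theorem toReal_zsmul (m : ℤ) (a : Fin d → ℤ) : toReal (m • a) = (m : ℝ) • toReal a := by
  ext; simp [toReal]

variable {A : Finset (Fin d → ℤ)}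

theorem toReal_mem_cone {a : Fin d → ℤ} (ha : a ∈ A) : toReal a ∈ cone A :=
  Submodule.subset_span ⟨a, ha, rfl⟩

theorem mem_cone_iff {x : Fin d → ℝ} :
    x ∈ cone A ↔ ∃ r : (Fin d → ℤ) → ℝ, (∀ a, 0 ≤ r a) ∧ ∑ a ∈ A, r a • toReal a = x := by
  classical
  constructor
  · intro hx
    induction hx using Submodule.span_induction with
    | mem x hx =>
      obtain ⟨a, ha, rfl⟩ := hx
      refine ⟨Pi.single a 1, fun b => ?_, ?_⟩
      · by_cases h : b = a
        · subst h; simp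
        · simp [h]
      · rw [Finset.sum_eq_single a (fun b _ h => by simp [h]) (fun h => absurd ha h)]
        simp
    | zero => exact ⟨0, fun _ => le_rfl, by simp⟩
    | add x y _ _ hx hy =>
      obtain ⟨r, hr, rfl⟩ := hx
      obtain ⟨s, hs, rfl⟩ := hy
      exact ⟨r + s, fun a => add_nonneg (hr a) (hs a), by simp [add_smul, Finset.sum_add_distrib]⟩
    | smul c x _ hx =>
      obtain ⟨r, hr, rfl⟩ := hx
      refine ⟨fun a => (c : ℝ) * r a, fun a => mul_nonneg c.2 (hr a), ?_⟩
      rw [show c • ∑ a ∈ A, r a • toReal a = (c : ℝ) • ∑ a ∈ A, r a • toReal a from rfl,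
        Finset.smul_sum]
      simp [mul_smul]
  · rintro ⟨r, hr, rfl⟩
    exact sum_mem fun a ha => PointedCone.smul_mem _ (hr a) (toReal_mem_cone ha)

theorem cone_le_iff {C : PointedCone ℝ (Fin d → ℝ)} : cone A ≤ C ↔ ∀ a ∈ A, toReal a ∈ C := by
  simp [cone, PointedCone.hull, Submodule.span_le, Set.subset_def]

theorem nonneg_of_mem_cone {F : (Fin d → ℝ) →ₗ[ℝ] ℝ} (hF : ∀ a ∈ A, 0 ≤ F (toReal a))
    {x : Fin d → ℝ} (hx : x ∈ cone A) : 0 ≤ F x := by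
  obtain ⟨r, hr, rfl⟩ := mem_cone_iff.mp hx
  rw [map_sum]
  exact Finset.sum_nonneg fun a ha => by
    rw [map_smul]
    exact mul_nonneg (hr a) (hF a ha)

theorem eq_zero_of_forall_toReal (hA : AddSubgroup.closure (A : Set (Fin d → ℤ)) = ⊤)
    {F : (Fin d → ℝ) →ₗ[ℝ] ℝ} (hF : ∀ a ∈ A, F (toReal a) = 0) : F = 0 := by
  have h : ∀ v : Fin d → ℤ, F (toReal v) = 0 := by
    have h1 : AddSubgroup.closure (A : Set (Fin d → ℤ)) ≤
        (F.toAddMonoidHom.comp (toRealHom d)).ker :=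
      (AddSubgroup.closure_le _).mpr fun a ha => hF a ha
    rw [hA] at h1
    exact fun v => h1 (AddSubgroup.mem_top v)
  refine LinearMap.pi_ext' fun i => LinearMap.ext_ring ?_
  have h2 : toReal (Pi.single i 1) = Pi.single i (1 : ℝ) := by
    ext j
    by_cases hj : j = i
    · subst hj; simp [toReal]
    · simp [toReal, hj]
  simpa [h2] using h (Pi.single i 1)

/-- The intersection of a cone with the kernel of a linear form. -/
def zeroFace (C : PointedCone ℝ (Fin d → ℝ)) (F : (Fin d → ℝ) →ₗ[ℝ] ℝ) :
    PointedCone ℝ (Fin d → ℝ) :=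
  C ⊓ PointedCone.ofSubmodule (LinearMap.ker F)

theorem mem_zeroFace {C : PointedCone ℝ (Fin d → ℝ)} {F : (Fin d → ℝ) →ₗ[ℝ] ℝ}
    {x : Fin d → ℝ} : x ∈ zeroFace C F ↔ x ∈ C ∧ F x = 0 :=
  Iff.rfl

theorem isFaceOf_zeroFace {C : PointedCone ℝ (Fin d → ℝ)} {F : (Fin d → ℝ) →ₗ[ℝ] ℝ}
    (hF : ∀ x ∈ C, 0 ≤ F x) : (zeroFace C F).IsFaceOf C := by
  refine PointedCone.IsFaceOf.of_mem_of_add_mem_left inf_le_left fun {x y} hx hy h => ?_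
  have h1 := (mem_zeroFace.mp h).2
  rw [map_add] at h1
  exact mem_zeroFace.mpr ⟨hx, by linarith [hF x hx, hF y hy]⟩

theorem zeroFace_cone_ne (hA : AddSubgroup.closure (A : Set (Fin d → ℤ)) = ⊤)
    {F : (Fin d → ℝ) →ₗ[ℝ] ℝ} (hF : F ≠ 0) : zeroFace (cone A) F ≠ cone A := by
  intro h
  refine hF (eq_zero_of_forall_toReal hA fun a ha => ?_)
  have := toReal_mem_cone ha
  rw [← h] at this
  exact this.2

theorem zeroFace_cone_le {F G : (Fin d → ℝ) →ₗ[ℝ] ℝ} (hF : ∀ a ∈ A, 0 ≤ F (toReal a))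
    (h : ∀ a ∈ A, F (toReal a) = 0 → G (toReal a) = 0) :
    zeroFace (cone A) F ≤ zeroFace (cone A) G := by
  rintro x ⟨hx, hFx⟩
  refine ⟨hx, ?_⟩
  obtain ⟨r, hr, rfl⟩ := mem_cone_iff.mp hx
  replace hFx : F (∑ a ∈ A, r a • toReal a) = 0 := hFx
  change G _ = 0
  simp only [map_sum, map_smul, smul_eq_mul] at hFx ⊢
  rw [Finset.sum_eq_zero_iff_of_nonneg fun a ha => mul_nonneg (hr a) (hF a ha)] at hFx
  refine Finset.sum_eq_zero fun a ha => ?_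
  rcases mul_eq_zero.mp (hFx a ha) with h0 | h0
  · rw [h0, zero_mul]
  · rw [h a ha h0, mul_zero]

/-- The elements of `A` in the kernel of `F` span the kernel of `F`, expressed dually. -/
def ZerosSpan (A : Finset (Fin d → ℤ)) (F : (Fin d → ℝ) →ₗ[ℝ] ℝ) : Prop :=
  ∀ H : (Fin d → ℝ) →ₗ[ℝ] ℝ, (∀ a ∈ A, F (toReal a) = 0 → H (toReal a) = 0) → ∃ c : ℝ, H = c • F

theorem ZerosSpan.smul {F : (Fin d → ℝ) →ₗ[ℝ] ℝ} (hF : ZerosSpan A F) {c : ℝ} (hc : c ≠ 0) :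
    ZerosSpan A (c • F) := by
  intro H hH
  obtain ⟨e, rfl⟩ := hF H fun a ha h => hH a ha (by simp [h])
  exact ⟨e * c⁻¹, by rw [smul_smul, mul_assoc, inv_mul_cancel₀ hc, mul_one]⟩

theorem IsPrimitiveSupport.ne_zero {C σ : PointedCone ℝ (Fin d → ℝ)}
    {F : (Fin d → ℝ) →ₗ[ℝ] ℝ} (hF : IsPrimitiveSupport C σ F) : F ≠ 0 := by
  rintro rfl
  have : ((1 : ℤ) : ℝ) ∈ Set.range (fun m : ℤ => (m : ℝ)) := ⟨1, rfl⟩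
  rw [← hF.image_int] at this
  obtain ⟨a, ha⟩ := this
  simp at ha

/-- If `H` is not a multiple of `F`, subtract the multiple of `F` given by the least ratio `H/F`.
The result is nonnegative on `A` and vanishes on `σ` and at some `b` with `F b ≠ 0`, so it cuts out
a proper face larger than the facet. -/
theorem IsFacet.zerosSpan (hA : AddSubgroup.closure (A : Set (Fin d → ℤ)) = ⊤)
    {σ : PointedCone ℝ (Fin d → ℝ)} (hσ : IsFacet σ (cone A)) {F : (Fin d → ℝ) →ₗ[ℝ] ℝ}
    (hF : IsPrimitiveSupport (cone A) σ F) : ZerosSpan A F := by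
  classical
  intro H hH
  have hFA : ∀ a ∈ A, 0 ≤ F (toReal a) := fun a ha => hF.nonneg _ (toReal_mem_cone ha)
  obtain ⟨a₀, ha₀, ha₀F⟩ : ∃ a ∈ A, F (toReal a) ≠ 0 := by
    by_contra! h
    exact hF.ne_zero (eq_zero_of_forall_toReal hA h)
  obtain ⟨b, hb, hmin⟩ := (A.filter fun a => F (toReal a) ≠ 0).exists_min_image
    (fun a => H (toReal a) / F (toReal a)) ⟨a₀, Finset.mem_filter.mpr ⟨ha₀, ha₀F⟩⟩
  obtain ⟨hbA, hbF⟩ := Finset.mem_filter.mp hb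
  set t := H (toReal b) / F (toReal b) with ht
  refine ⟨t, ?_⟩
  by_contra hne
  have hG : ∀ a ∈ A, 0 ≤ (H - t • F) (toReal a) := by
    intro a ha
    simp only [LinearMap.sub_apply, LinearMap.smul_apply, smul_eq_mul, sub_nonneg]
    by_cases h0 : F (toReal a) = 0
    · rw [h0, hH a ha h0, mul_zero]
    · rw [← le_div_iff₀ (lt_of_le_of_ne (hFA a ha) (Ne.symm h0))]
      exact hmin a (Finset.mem_filter.mpr ⟨ha, h0⟩)
  have hσF : σ ≤ zeroFace (cone A) F := fun x hx => ⟨hσ.prop.1.le hx, hF.eq_zero x hx⟩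
  have h1 : zeroFace (cone A) F ≤ zeroFace (cone A) (H - t • F) :=
    zeroFace_cone_le hFA fun a ha h0 => by simp [h0, hH a ha h0]
  have h2 : zeroFace (cone A) (H - t • F) ≤ σ :=
    hσ.2 ⟨isFaceOf_zeroFace fun x hx => nonneg_of_mem_cone hG hx,
      zeroFace_cone_ne hA (sub_ne_zero.mpr hne)⟩ (hσF.trans h1)
  refine hbF (hF.eq_zero _ (h2 ⟨toReal_mem_cone hbA, ?_⟩))
  change (H - t • F) (toReal b) = 0
  simp [ht, hbF]

/-- A strictly larger face `τ` contains some `y` with `F y > 0`. For `a ∈ A` a suitable `a - t y`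
lies in the kernel of `F`, hence in `τ - τ`; so `a + u ∈ τ` for some `u ∈ τ`, and `a ∈ τ` as `τ` is
a face. -/
theorem ZerosSpan.isFacet (hA : AddSubgroup.closure (A : Set (Fin d → ℤ)) = ⊤)
    {F : (Fin d → ℝ) →ₗ[ℝ] ℝ} (h0 : F ≠ 0) (hFA : ∀ a ∈ A, 0 ≤ F (toReal a))
    (hF : ZerosSpan A F) : IsFacet (zeroFace (cone A) F) (cone A) := by
  refine ⟨⟨isFaceOf_zeroFace fun x hx => nonneg_of_mem_cone hFA hx, zeroFace_cone_ne hA h0⟩, ?_⟩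
  rintro τ ⟨hτ, hne⟩ hle y hy
  refine ⟨hτ.le hy, ?_⟩
  by_contra hFy
  replace hFy : F y ≠ 0 := hFy
  have hFy' : 0 < F y := lt_of_le_of_ne (nonneg_of_mem_cone hFA (hτ.le hy)) (Ne.symm hFy)
  refine hne (le_antisymm hτ.le (cone_le_iff.mpr fun a ha => ?_))
  set t := F (toReal a) / F y
  have hz : toReal a - t • y ∈
      Submodule.span ℝ {x | ∃ b ∈ A, F (toReal b) = 0 ∧ x = toReal b} := by
    by_contra hz
    obtain ⟨H, hHz, hH⟩ := Submodule.exists_le_ker_of_notMem hz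
    obtain ⟨c, rfl⟩ := hF H fun b hb h0 => hH (Submodule.subset_span ⟨b, hb, h0, rfl⟩)
    exact hHz (by simp [t, hFy])
  have hspan : ∀ z ∈ Submodule.span ℝ {x | ∃ b ∈ A, F (toReal b) = 0 ∧ x = toReal b},
      ∃ u ∈ τ, z + u ∈ τ := by
    intro z hz
    induction hz using Submodule.span_induction with
    | mem z hz =>
      obtain ⟨b, hb, hb0, rfl⟩ := hz
      exact ⟨0, zero_mem _, by rw [add_zero]; exact hle ⟨toReal_mem_cone hb, hb0⟩⟩
    | zero => exact ⟨0, zero_mem _, by simp⟩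
    | add z w _ _ hz hw =>
      obtain ⟨u, hu, hzu⟩ := hz
      obtain ⟨v, hv, hwv⟩ := hw
      exact ⟨u + v, add_mem hu hv, by rw [add_add_add_comm]; exact add_mem hzu hwv⟩
    | smul c z _ hz =>
      obtain ⟨u, hu, hzu⟩ := hz
      rcases le_total 0 c with hc | hc
      · exact ⟨c • u, PointedCone.smul_mem _ hc hu, by
          rw [← smul_add]; exact PointedCone.smul_mem _ hc hzu⟩
      · refine ⟨(-c) • (z + u), PointedCone.smul_mem _ (neg_nonneg.mpr hc) hzu, ?_⟩
        rw [show c • z + (-c) • (z + u) = (-c) • u by module]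
        exact PointedCone.smul_mem _ (neg_nonneg.mpr hc) hu
  obtain ⟨u, hu, hzu⟩ := hspan _ hz
  refine hτ.mem_of_add_mem_left (toReal_mem_cone ha) (hτ.le hu) ?_
  rw [show toReal a + u = (toReal a - t • y + u) + t • y by module]
  exact add_mem hzu (PointedCone.smul_mem _ (div_nonneg (hFA a ha) hFy'.le) hy)

/-- A form that is nonnegative on `A` and negative at `x` can be chosen so that its zeros in `A`
span its kernel. -/
theorem exists_zerosSpan_of_notMem_cone (hA : AddSubgroup.closure (A : Set (Fin d → ℤ)) = ⊤)
    {x : Fin d → ℝ} (hx : x ∉ cone A) :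
    ∃ G : (Fin d → ℝ) →ₗ[ℝ] ℝ, (∀ a ∈ A, 0 ≤ G (toReal a)) ∧ G x < 0 ∧ ZerosSpan A G := by
  classical
  let zeros : ((Fin d → ℝ) →ₗ[ℝ] ℝ) → Finset (Fin d → ℤ) := fun G => A.filter fun a =>
    G (toReal a) = 0
  let good : Set ((Fin d → ℝ) →ₗ[ℝ] ℝ) := {G | (∀ a ∈ A, 0 ≤ G (toReal a)) ∧ G x < 0}
  -- Among the separating forms, one with the most zeros in `A` is chosen.
  have hne : ((fun G => (zeros G).card) '' good).Nonempty := by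
    obtain ⟨G, hG, hGx⟩ := exists_neg_of_notMem_hull ((A.finite_toSet).image toReal) hx
    exact ⟨_, G, ⟨fun a ha => hG _ ⟨a, ha, rfl⟩, hGx⟩, rfl⟩
  have hbdd : BddAbove ((fun G => (zeros G).card) '' good) :=
    ⟨A.card, by rintro _ ⟨G, _, rfl⟩; exact Finset.card_filter_le _ _⟩
  obtain ⟨G, ⟨hGA, hGx⟩, hG⟩ := Nat.sSup_mem hne hbdd
  have hmax : ∀ G' ∈ good, (zeros G').card ≤ (zeros G).card := fun G' hG' => by
    have := le_csSup hbdd ⟨G', hG', rfl⟩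
    rw [← hG] at this
    exact this
  -- Otherwise move from `G` in direction `H` until a generator first reaches zero: the value at `x`
  -- is unchanged and a zero is gained. Applied to both `H` and `-H`, this forces `H = 0`.
  have key : ∀ H : (Fin d → ℝ) →ₗ[ℝ] ℝ, (∀ a ∈ A, G (toReal a) = 0 → H (toReal a) = 0) →
      H x = 0 → ∀ a ∈ A, 0 ≤ H (toReal a) := by
    intro H hH hHx
    by_contra! hneg
    obtain ⟨a₀, ha₀, ha₀H⟩ := hneg
    obtain ⟨b, hb, hmin⟩ := (A.filter fun a => H (toReal a) < 0).exists_min_image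
      (fun a => G (toReal a) / -H (toReal a)) ⟨a₀, Finset.mem_filter.mpr ⟨ha₀, ha₀H⟩⟩
    obtain ⟨hbA, hbH⟩ := Finset.mem_filter.mp hb
    set t := G (toReal b) / -H (toReal b) with ht
    have ht0 : 0 ≤ t := div_nonneg (hGA b hbA) (by linarith)
    have hgood : G + t • H ∈ good := by
      refine ⟨fun a ha => ?_, by simpa [hHx] using hGx⟩
      simp only [LinearMap.add_apply, LinearMap.smul_apply, smul_eq_mul]
      rcases le_or_gt 0 (H (toReal a)) with h | h
      · exact add_nonneg (hGA a ha) (mul_nonneg ht0 h)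
      · have := hmin a (Finset.mem_filter.mpr ⟨ha, h⟩)
        rw [le_div_iff₀ (by linarith)] at this
        linarith
    refine absurd (hmax _ hgood) (not_le.mpr (Finset.card_lt_card ⟨fun a ha => ?_, fun h => ?_⟩))
    · obtain ⟨ha, ha0⟩ := Finset.mem_filter.mp ha
      exact Finset.mem_filter.mpr ⟨ha, by simp [ha0, hH a ha ha0]⟩
    · have h1 : b ∈ zeros (G + t • H) := by
        refine Finset.mem_filter.mpr ⟨hbA, ?_⟩
        simp only [LinearMap.add_apply, LinearMap.smul_apply, smul_eq_mul, ht]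
        field_simp [hbH.ne]
        ring
      exact hbH.ne (hH b hbA (Finset.mem_filter.mp (h h1)).2)
  refine ⟨G, hGA, hGx, fun H hH => ⟨H x / G x, ?_⟩⟩
  rw [← sub_eq_zero]
  have h0 : ∀ a ∈ A, G (toReal a) = 0 → (H - (H x / G x) • G) (toReal a) = 0 := fun a ha h => by
    simp [h, hH a ha h]
  have hx0 : (H - (H x / G x) • G) x = 0 := by simp [hGx.ne]
  refine eq_zero_of_forall_toReal hA fun a ha => le_antisymm ?_ (key _ h0 hx0 a ha)
  have := key (-(H - (H x / G x) • G)) (fun a ha h => by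
    rw [LinearMap.neg_apply, h0 a ha h, neg_zero]) (by rw [LinearMap.neg_apply, hx0, neg_zero]) a ha
  rwa [LinearMap.neg_apply, neg_nonneg] at this

/-- An integral vector either has a nonzero multiple in the group generated by `B`, or is separated
from `B` by an integral linear form. -/
theorem exists_smul_mem_closure_or_exists_form (B : Set (Fin d → ℤ)) (v : Fin d → ℤ) :
    (∃ m : ℤ, m ≠ 0 ∧ m • v ∈ AddSubgroup.closure B) ∨
      ∃ n : Fin d → ℤ, (∀ b ∈ B, ∑ i, n i * b i = 0) ∧ ∑ i, n i * v i ≠ 0 := by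
  let toRat : (Fin d → ℤ) → (Fin d → ℚ) := fun a i => a i
  by_cases hv : toRat v ∈ Submodule.span ℚ (toRat '' B)
  · left
    have h : ∀ x ∈ Submodule.span ℚ (toRat '' B),
        ∃ m : ℤ, m ≠ 0 ∧ ∃ w ∈ AddSubgroup.closure B, toRat w = (m : ℚ) • x := by
      intro x hx
      induction hx using Submodule.span_induction with
      | mem x hx =>
        obtain ⟨b, hb, rfl⟩ := hx
        exact ⟨1, one_ne_zero, b, AddSubgroup.subset_closure hb, by simp⟩
      | zero => exact ⟨1, one_ne_zero, 0, zero_mem _, by ext; simp [toRat]⟩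
      | add x y _ _ hx hy =>
        obtain ⟨m, hm, w, hw, hwx⟩ := hx
        obtain ⟨n, hn, z, hz, hzy⟩ := hy
        refine ⟨m * n, mul_ne_zero hm hn, n • w + m • z,
          add_mem (zsmul_mem hw n) (zsmul_mem hz m), ?_⟩
        ext i
        have h1 := congrFun hwx i
        have h2 := congrFun hzy i
        simp only [toRat, Pi.smul_apply, Pi.add_apply, smul_eq_mul] at h1 h2 ⊢
        push_cast
        rw [h1, h2]
        ring
      | smul c x _ hx =>
        obtain ⟨m, hm, w, hw, hwx⟩ := hx
        refine ⟨m * c.den, mul_ne_zero hm (by exact_mod_cast c.den_nz), c.num • w,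
          zsmul_mem hw _, ?_⟩
        ext i
        have h1 := congrFun hwx i
        simp only [toRat, Pi.smul_apply, smul_eq_mul] at h1 ⊢
        push_cast
        rw [h1]
        have := Rat.mul_den_eq_num c
        rw [← this]
        ring
    obtain ⟨m, hm, w, hw, hwv⟩ := h _ hv
    refine ⟨m, hm, ?_⟩
    have : m • v = w := by
      ext i
      have := congrFun hwv i
      simp only [toRat, Pi.smul_apply, smul_eq_mul] at this
      rw [Pi.smul_apply, smul_eq_mul]
      exact_mod_cast this.symm
    rwa [this]
  · right
    -- A rational form separates `v` from the span; clearing the denominators of its coefficients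
    -- makes it integral.
    obtain ⟨f, hfv, hf⟩ := Submodule.exists_le_ker_of_notMem hv
    obtain ⟨N, hN⟩ := IsLocalization.exist_integer_multiples_of_finite (nonZeroDivisors ℤ)
      fun i => f (Pi.single i 1)
    choose n hn using hN
    have hN0 : ((N : ℤ) : ℚ) ≠ 0 := by exact_mod_cast nonZeroDivisors.ne_zero N.2
    have hf' : ∀ a : Fin d → ℤ, ((∑ i, n i * a i : ℤ) : ℚ) = (N : ℤ) * f (toRat a) := by
      intro a
      have h1 : toRat a = ∑ i, (a i : ℚ) • Pi.single i (1 : ℚ) := by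
        ext j
        simp [toRat, Finset.sum_apply, Pi.single_apply]
      rw [h1, map_sum, Finset.mul_sum]
      push_cast
      refine Finset.sum_congr rfl fun i _ => ?_
      have h2 := hn i
      simp only [algebraMap_int_eq, Int.coe_castRingHom, zsmul_eq_mul] at h2
      rw [h2, map_smul, smul_eq_mul]
      ring
    refine ⟨n, fun b hb => ?_, fun h => ?_⟩
    · have h1 : f (toRat b) = 0 := hf (Submodule.subset_span ⟨b, hb, rfl⟩)
      have h2 := hf' b
      rw [h1, mul_zero] at h2
      exact_mod_cast h2
    · have h2 := hf' v
      rw [h, Int.cast_zero] at h2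
      exact (mul_ne_zero hN0 hfv) h2.symm

/-- The real linear form with integral coefficients `n`. -/
def intForm (n : Fin d → ℤ) : (Fin d → ℝ) →ₗ[ℝ] ℝ :=
  ∑ i, (n i : ℝ) • LinearMap.proj i

theorem intForm_toReal (n a : Fin d → ℤ) : intForm n (toReal a) = ((∑ i, n i * a i : ℤ) : ℝ) := by
  simp [intForm, toReal]

/-- An integral form separating `v` from the zeros of `F` in `A` would be a multiple of `F`, hence
zero at `v`. -/
theorem ZerosSpan.exists_smul_mem_closure {F : (Fin d → ℝ) →ₗ[ℝ] ℝ} (hF : ZerosSpan A F)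
    {v : Fin d → ℤ} (hv : F (toReal v) = 0) :
    ∃ m : ℤ, m ≠ 0 ∧ m • v ∈ AddSubgroup.closure {a | a ∈ A ∧ F (toReal a) = 0} := by
  refine (exists_smul_mem_closure_or_exists_form _ v).resolve_right ?_
  rintro ⟨n, hn, hnv⟩
  obtain ⟨c, hc⟩ := hF (intForm n) fun a ha h => by
    rw [intForm_toReal, hn a ⟨ha, h⟩, Int.cast_zero]
  have h := LinearMap.congr_fun hc (toReal v)
  rw [intForm_toReal, LinearMap.smul_apply, hv, smul_zero] at h
  exact hnv (by exact_mod_cast h)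

/-- Some nonzero multiple of `G` is integral; dividing it by a generator of its image on `ℤᵈ`, with
the sign that keeps the multiple positive, makes it primitive. -/
theorem ZerosSpan.exists_isPrimitiveSupport
    (hA : AddSubgroup.closure (A : Set (Fin d → ℤ)) = ⊤) {G : (Fin d → ℝ) →ₗ[ℝ] ℝ} (h0 : G ≠ 0)
    (hGA : ∀ a ∈ A, 0 ≤ G (toReal a)) (hG : ZerosSpan A G) :
    ∃ c : ℝ, 0 < c ∧ IsPrimitiveSupport (cone A) (zeroFace (cone A) (c • G)) (c • G) := by
  obtain ⟨v, hv, hGv⟩ : ∃ a ∈ A, G (toReal a) ≠ 0 := by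
    by_contra! h
    exact h0 (eq_zero_of_forall_toReal hA h)
  obtain ⟨n, hn, hnv⟩ := (exists_smul_mem_closure_or_exists_form
    {a | a ∈ A ∧ G (toReal a) = 0} v).resolve_left (by
      rintro ⟨m, hm, hmv⟩
      have hle : AddSubgroup.closure {a | a ∈ A ∧ G (toReal a) = 0} ≤
          (G.toAddMonoidHom.comp (toRealHom d)).ker :=
        (AddSubgroup.closure_le _).mpr fun a ha => ha.2
      have h1 : G (toReal (m • v)) = 0 := hle hmv
      rw [toReal_zsmul, map_smul, smul_eq_mul] at h1
      exact (mul_ne_zero (by exact_mod_cast hm) hGv) h1)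
  obtain ⟨e, he⟩ := hG (intForm n) fun a ha h => by
    rw [intForm_toReal, hn a ⟨ha, h⟩, Int.cast_zero]
  have heG : ∀ a : Fin d → ℤ, ((∑ i, n i * a i : ℤ) : ℝ) = e * G (toReal a) := fun a => by
    rw [← intForm_toReal, he, LinearMap.smul_apply, smul_eq_mul]
  have he0 : e ≠ 0 := by
    rintro rfl
    have h := heG v
    rw [zero_mul] at h
    exact hnv (by exact_mod_cast h)
  let ν : (Fin d → ℤ) →+ ℤ :=
    { toFun := fun a => ∑ i, n i * a i
      map_zero' := by simp
      map_add' := fun a b => by simp [mul_add, Finset.sum_add_distrib] }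
  obtain ⟨g, hg, heg⟩ : ∃ g : ℤ, ν.range = AddSubgroup.zmultiples g ∧ 0 < e / g := by
    obtain ⟨g, hg⟩ := Int.subgroup_cyclic ν.range
    rw [← AddSubgroup.zmultiples_eq_closure] at hg
    have hg0 : g ≠ 0 := by
      rintro rfl
      have h : ν v ∈ ν.range := ⟨v, rfl⟩
      rw [hg] at h
      simp only [AddSubgroup.zmultiples_zero_eq_bot, AddSubgroup.mem_bot] at h
      exact hnv h
    have hg0' : (g : ℝ) ≠ 0 := by exact_mod_cast hg0
    rcases lt_or_gt_of_ne (div_ne_zero he0 hg0') with h | h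
    · exact ⟨-g, by rw [hg, AddSubgroup.zmultiples_neg], by push_cast; rw [div_neg]; linarith⟩
    · exact ⟨g, hg, h⟩
  have hg0 : (g : ℝ) ≠ 0 := by
    intro h
    rw [h, div_zero] at heg
    exact lt_irrefl _ heg
  refine ⟨e / g, heg, ?_, fun x hx => hx.2, ?_⟩
  · intro x hx
    rw [LinearMap.smul_apply]
    exact mul_nonneg heg.le (nonneg_of_mem_cone hGA hx)
  · have hval : ∀ a : Fin d → ℤ, ((e / g) • G) (toReal a) = (ν a : ℝ) / g := fun a => by
      rw [LinearMap.smul_apply, smul_eq_mul, div_mul_eq_mul_div, ← heG]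
      rfl
    ext y
    constructor
    · rintro ⟨a, rfl⟩
      have h : ν a ∈ AddSubgroup.zmultiples g := hg ▸ ⟨a, rfl⟩
      obtain ⟨m, hm⟩ := AddSubgroup.mem_zmultiples_iff.mp h
      refine ⟨m, ?_⟩
      change (m : ℝ) = ((e / g) • G) (toReal a)
      rw [hval, ← hm, smul_eq_mul]
      push_cast
      field_simp
    · rintro ⟨m, rfl⟩
      have h : m • g ∈ ν.range := hg ▸ AddSubgroup.mem_zmultiples_iff.mpr ⟨m, rfl⟩
      obtain ⟨a, ha⟩ := h
      refine ⟨a, ?_⟩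
      change ((e / g) • G) (toReal a) = m
      rw [hval, ha, smul_eq_mul]
      push_cast
      field_simp

/-- A full-dimensional rational cone is cut out by the primitive support functions of its
facets. -/
theorem mem_cone_of_forall_isFacet (hA : AddSubgroup.closure (A : Set (Fin d → ℤ)) = ⊤)
    {x : Fin d → ℝ} (hx : ∀ σ : PointedCone ℝ (Fin d → ℝ), IsFacet σ (cone A) →
      ∀ F : (Fin d → ℝ) →ₗ[ℝ] ℝ, IsPrimitiveSupport (cone A) σ F → 0 ≤ F x) : x ∈ cone A := by
  by_contra hx'
  obtain ⟨G, hGA, hGx, hG⟩ := exists_zerosSpan_of_notMem_cone hA hx'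
  have h0 : G ≠ 0 := by rintro rfl; simp at hGx
  obtain ⟨c, hc, hF⟩ := hG.exists_isPrimitiveSupport hA h0 hGA
  have h1 := hx _ ((hG.smul hc.ne').isFacet hA (smul_ne_zero hc.ne' h0)
    (fun a ha => mul_nonneg hc.le (hGA a ha))) _ hF
  rw [LinearMap.smul_apply, smul_eq_mul] at h1
  nlinarith

end Cone

/-! ### A conductor for the semigroup -/

section Conductor

variable {d : ℕ} {A : Finset (Fin d → ℤ)}

theorem exists_sub_of_closure_eq_top (hA : AddSubgroup.closure (A : Set (Fin d → ℤ)) = ⊤)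
    (x : Fin d → ℤ) : ∃ u ∈ semigroup A, ∃ v ∈ semigroup A, x + v = u := by
  have hx : x ∈ AddSubgroup.closure (A : Set (Fin d → ℤ)) := hA ▸ AddSubgroup.mem_top x
  induction hx using AddSubgroup.closure_induction with
  | mem x hx => exact ⟨x, AddSubmonoid.subset_closure hx, 0, zero_mem _, add_zero x⟩
  | zero => exact ⟨0, zero_mem _, 0, zero_mem _, add_zero 0⟩
  | add x y _ _ hx hy =>
    obtain ⟨u, hu, v, hv, rfl⟩ := hx
    obtain ⟨u', hu', v', hv', rfl⟩ := hy
    exact ⟨_, add_mem hu hu', _, add_mem hv hv', add_add_add_comm _ _ _ _⟩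
  | neg x _ hx =>
    obtain ⟨u, hu, v, hv, rfl⟩ := hx
    exact ⟨v, hv, _, hu, by abel⟩

/-- The semigroup `ℕA` contains a translate of the set of all lattice points of the cone. -/
theorem exists_conductor (hA : AddSubgroup.closure (A : Set (Fin d → ℤ)) = ⊤) :
    ∃ c ∈ semigroup A, ∀ x : Fin d → ℤ, toReal x ∈ cone A → c + x ∈ semigroup A := by
  classical
  choose u hu v hv huv using exists_sub_of_closure_eq_top hA
  let bound : Fin d → ℤ := ∑ a ∈ A, |a|
  let box : Finset (Fin d → ℤ) := Finset.Icc (-bound) bound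
  -- Rounding down the cone coefficients of `x` leaves a remainder in the finite `box`. The
  -- conductor sums a denominator `v y` for every possible remainder `y`, so the matching summand
  -- moves the remainder into `ℕA` and the others stay there.
  refine ⟨∑ y ∈ box, v y, sum_mem fun y _ => hv y, fun x hx => ?_⟩
  obtain ⟨r, hr, hrx⟩ := mem_cone_iff.mp hx
  let n : Fin d → ℤ := ∑ a ∈ A, ⌊r a⌋₊ • a
  have hn : n ∈ semigroup A :=
    sum_mem fun a ha => nsmul_mem (AddSubmonoid.subset_closure ha) _
  have hbox : x - n ∈ box := by
    have h : ∀ i, |(x - n) i| ≤ bound i := by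
      intro i
      have h1 : (((x - n) i : ℤ) : ℝ) = ∑ a ∈ A, (r a - ⌊r a⌋₊) * (a i : ℝ) := by
        have h2 : (x i : ℝ) = ∑ a ∈ A, r a * (a i : ℝ) := by
          simpa [toReal, Finset.sum_apply] using (congrFun hrx i).symm
        simp only [n, Pi.sub_apply, Finset.sum_apply, nsmul_eq_mul, Pi.mul_apply, Pi.natCast_apply]
        push_cast
        rw [h2, ← Finset.sum_sub_distrib]
        exact Finset.sum_congr rfl fun a _ => by ring
      have h3 : |(((x - n) i : ℤ) : ℝ)| ≤ ((bound i : ℤ) : ℝ) := by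
        rw [h1]
        refine (Finset.abs_sum_le_sum_abs _ _).trans ?_
        simp only [bound, Finset.sum_apply, Pi.abs_apply]
        push_cast
        refine Finset.sum_le_sum fun a _ => ?_
        rw [abs_mul]
        refine mul_le_of_le_one_left (abs_nonneg _) ?_
        rw [abs_le]
        constructor <;> linarith [Nat.floor_le (hr a), Nat.lt_floor_add_one (r a)]
      exact_mod_cast h3
    exact Finset.mem_Icc.mpr ⟨fun i => (abs_le.mp (h i)).1, fun i => (abs_le.mp (h i)).2⟩
  rw [← Finset.add_sum_erase _ _ hbox,
    show v (x - n) + ∑ y ∈ box.erase (x - n), v y + x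
      = (x - n + v (x - n)) + n + ∑ y ∈ box.erase (x - n), v y by abel, huv]
  exact add_mem (add_mem (hu _) hn) (sum_mem fun y _ => hv y)

end Conductor

/-! ### The Laurent ring and polynomiality of coefficients -/

section Laurent

variable {d : ℕ} {A : Finset (Fin d → ℤ)}

/-- The Laurent polynomial ring `ℂ[ℤᵈ]`. -/
abbrev LaurentRing (d : ℕ) : Type :=
  AddMonoidAlgebra ℂ (Fin d → ℤ)

noncomputable instance : Algebra (SemigroupRing A) (LaurentRing d) :=
  (AddMonoidAlgebra.mapDomainRingHom ℂ (semigroup A).subtype).toAlgebra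

theorem algebraMap_single (m : semigroup A) (r : ℂ) :
    algebraMap (SemigroupRing A) (LaurentRing d) (AddMonoidAlgebra.single m r) =
      AddMonoidAlgebra.single (m : Fin d → ℤ) r :=
  AddMonoidAlgebra.mapDomain_single

theorem single_smul (m : semigroup A) (r : ℂ) (y : LaurentRing d) :
    (AddMonoidAlgebra.single m r : SemigroupRing A) • y =
      AddMonoidAlgebra.single (m : Fin d → ℤ) r * y := by
  rw [Algebra.smul_def, algebraMap_single]

instance : IsScalarTower ℂ (SemigroupRing A) (LaurentRing d) := by
  refine IsScalarTower.of_algebraMap_eq fun r => ?_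
  rw [AddMonoidAlgebra.coe_algebraMap, AddMonoidAlgebra.coe_algebraMap]
  exact (algebraMap_single 0 r).symm

theorem algebraMap_laurent_injective :
    Function.Injective (algebraMap (SemigroupRing A) (LaurentRing d)) :=
  AddMonoidAlgebra.mapDomain_injective Subtype.val_injective

theorem range_algebraMap_laurent :
    Set.range (algebraMap (SemigroupRing A) (LaurentRing d)) =
      AddMonoidAlgebra.supported ℂ ℂ (semigroup A : Set (Fin d → ℤ)) := by
  ext y
  constructor
  · rintro ⟨x, rfl⟩
    induction x using AddMonoidAlgebra.induction_linear with
    | zero => rw [map_zero]; exact zero_mem _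
    | add x y hx hy => rw [map_add]; exact add_mem hx hy
    | single m r =>
      rw [algebraMap_single]
      refine AddMonoidAlgebra.mem_supported'.mpr fun b hb => ?_
      rw [AddMonoidAlgebra.coeff_single, Finsupp.single_eq_of_ne]
      rintro rfl
      exact hb m.2
  · intro hy
    refine ⟨AddMonoidAlgebra.comapDomain _ Subtype.val_injective y,
      AddMonoidAlgebra.mapDomain_comapDomain ?_ Subtype.val_injective⟩
    rw [Subtype.range_coe]
    exact AddMonoidAlgebra.mem_supported.mp hy

theorem exists_unit_smul_eq_algebraMap (hA : AddSubgroup.closure (A : Set (Fin d → ℤ)) = ⊤)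
    (y : LaurentRing d) : ∃ w r : SemigroupRing A,
      IsUnit (algebraMap (SemigroupRing A) (LaurentRing d) w) ∧
        w • y = algebraMap (SemigroupRing A) (LaurentRing d) r := by
  induction y using AddMonoidAlgebra.induction_linear with
  | zero => exact ⟨1, 0, by simp, by simp⟩
  | add y z hy hz =>
    obtain ⟨w, r, hw, hr⟩ := hy
    obtain ⟨v, s, hv, hs⟩ := hz
    refine ⟨w * v, v * r + w * s, by rw [map_mul]; exact hw.mul hv, ?_⟩
    rw [smul_add, mul_comm, mul_smul, hr, mul_comm, mul_smul, hs, map_add, map_mul, map_mul,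
      Algebra.smul_def, Algebra.smul_def]
  | single x c =>
    obtain ⟨u, hu, v, hv, h⟩ := exists_sub_of_closure_eq_top hA x
    refine ⟨AddMonoidAlgebra.single ⟨v, hv⟩ 1, AddMonoidAlgebra.single ⟨u, hu⟩ c, ?_, ?_⟩
    · rw [algebraMap_single]
      refine IsUnit.of_mul_eq_one (AddMonoidAlgebra.single (-v) 1) ?_
      rw [AddMonoidAlgebra.single_mul_single, add_neg_cancel, one_mul, AddMonoidAlgebra.one_def]
    · rw [single_smul, algebraMap_single, AddMonoidAlgebra.single_mul_single, one_mul]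
      congr 1
      exact (add_comm v x).trans h

/-- The coefficients of a differential operator along a fixed degree shift form a polynomial
function. -/
theorem IsDiffOp.isPolyFn_coeff (hA : AddSubgroup.closure (A : Set (Fin d → ℤ)) = ⊤) {k : ℕ}
    {Q : Module.End ℂ (LaurentRing d)} (hQ : IsDiffOp (SemigroupRing A) k Q) (u : Fin d → ℤ) :
    IsPolyFn k fun b => (Q (AddMonoidAlgebra.single b 1)).coeff (u + b) := by
  have hcoeff : ∀ (Q : Module.End ℂ (LaurentRing d)) (c : semigroup A) (u b : Fin d → ℤ),
      (opComm (SemigroupRing A) (AddMonoidAlgebra.single c 1) Q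
        (AddMonoidAlgebra.single b 1)).coeff (u + c + b) =
      (Q (AddMonoidAlgebra.single b 1)).coeff (u + b) -
        (Q (AddMonoidAlgebra.single (b + c) 1)).coeff (u + (b + c)) := by
    intro Q c u b
    rw [opComm_apply, single_smul, single_smul, AddMonoidAlgebra.single_mul_single,
      AddMonoidAlgebra.coeff_sub, Finsupp.sub_apply, AddMonoidAlgebra.coeff_single_mul_apply,
      one_mul, one_mul, add_comm (c : Fin d → ℤ) b]
    congr 2 <;> abel
  induction k generalizing Q u with
  | zero =>
    have h1 : ∀ c ∈ semigroup A, ∀ b, (Q (AddMonoidAlgebra.single (b + c) 1)).coeff (u + (b + c)) =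
        (Q (AddMonoidAlgebra.single b 1)).coeff (u + b) := by
      intro c hc b
      have := hcoeff Q ⟨c, hc⟩ u b
      rw [isDiffOp_zero_iff.mp hQ, LinearMap.zero_apply, AddMonoidAlgebra.coeff_zero,
        Finsupp.zero_apply] at this
      exact (sub_eq_zero.mp this.symm).symm
    intro c b
    obtain ⟨p, hp, q, hq, h⟩ := exists_sub_of_closure_eq_top hA c
    have h2 := h1 p hp b
    have h3 := h1 q hq (b + c)
    rw [add_assoc b c q, h] at h3
    exact h3.symm.trans h2
  | succ k ih =>
    have h1 : ∀ c ∈ semigroup A, IsPolyFn k fun b =>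
        (Q (AddMonoidAlgebra.single b 1)).coeff (u + b) -
          (Q (AddMonoidAlgebra.single (b + c) 1)).coeff (u + (b + c)) := by
      intro c hc
      convert ih (hQ (AddMonoidAlgebra.single ⟨c, hc⟩ 1)) (u + c) using 2
      exact (hcoeff Q ⟨c, hc⟩ u _).symm
    intro c
    obtain ⟨p, hp, q, hq, h⟩ := exists_sub_of_closure_eq_top hA c
    -- With `c + q = p`, the difference along `c` is the one along `p` at `b` minus the one along
    -- `q` at `b + c`.
    have h2 := ((h1 q hq).comp (AddMonoidHom.id _) c).sub (h1 p hp)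
    convert h2 using 2 with b
    simp only [AddMonoidHom.id_apply]
    rw [add_comm c b, add_assoc b c q, h]
    ring

end Laurent

/-! ### The scored closure and the two-sided ideal -/

section Scored

variable {d : ℕ}

/-- The scored closure of `ℕA`. -/
def scoredClosure (A : Finset (Fin d → ℤ)) : Set (Fin d → ℤ) :=
  {a | ∀ σ : PointedCone ℝ (Fin d → ℝ), IsFacet σ (cone A) →
    ∀ F : (Fin d → ℝ) →ₗ[ℝ] ℝ, IsPrimitiveSupport (cone A) σ F →
      F (toReal a) ∈ (fun b => F (toReal b)) '' (semigroup A : Set (Fin d → ℤ))}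

variable {A : Finset (Fin d → ℤ)}

theorem semigroup_subset_scoredClosure :
    (semigroup A : Set (Fin d → ℤ)) ⊆ scoredClosure A :=
  fun a ha _ _ _ _ => ⟨a, ha, rfl⟩

theorem toReal_mem_cone_of_mem_semigroup {a : Fin d → ℤ} (ha : a ∈ semigroup A) :
    toReal a ∈ cone A := by
  induction ha using AddSubmonoid.closure_induction with
  | mem a ha => exact toReal_mem_cone ha
  | zero =>
    rw [show toReal (0 : Fin d → ℤ) = 0 from map_zero (toRealHom d)]
    exact zero_mem _
  | add a b _ _ ha hb => rw [toReal_add]; exact add_mem ha hb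

theorem toReal_mem_cone_of_mem_scoredClosure
    (hA : AddSubgroup.closure (A : Set (Fin d → ℤ)) = ⊤) {a : Fin d → ℤ}
    (ha : a ∈ scoredClosure A) : toReal a ∈ cone A := by
  refine mem_cone_of_forall_isFacet hA fun σ hσ F hF => ?_
  obtain ⟨b, hb, hba⟩ := ha σ hσ F hF
  exact hba ▸ hF.nonneg _ (toReal_mem_cone_of_mem_semigroup hb)

/-- A differential operator preserving `ℂ[ℕA]` preserves the span of the monomials with exponents
in the scored closure. -/
theorem map_supported_scoredClosure (hA : AddSubgroup.closure (A : Set (Fin d → ℤ)) = ⊤)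
    {Q : Module.End ℂ (LaurentRing d)} (hQ : Q ∈ diffOps ℂ (SemigroupRing A) (LaurentRing d))
    (hQA : ∀ y ∈ AddMonoidAlgebra.supported ℂ ℂ (semigroup A : Set (Fin d → ℤ)),
      Q y ∈ AddMonoidAlgebra.supported ℂ ℂ (semigroup A : Set (Fin d → ℤ)))
    {y : LaurentRing d} (hy : y ∈ AddMonoidAlgebra.supported ℂ ℂ (scoredClosure A)) :
    Q y ∈ AddMonoidAlgebra.supported ℂ ℂ (scoredClosure A) := by
  obtain ⟨k, hk⟩ := hQ
  suffices h : AddMonoidAlgebra.supported ℂ ℂ (scoredClosure A) ≤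
      (AddMonoidAlgebra.supported ℂ ℂ (scoredClosure A)).comap Q from h hy
  rw [AddMonoidAlgebra.supported_eq_span_single, Submodule.span_le,
    ← AddMonoidAlgebra.supported_eq_span_single]
  rintro _ ⟨s, hs, rfl⟩
  refine AddMonoidAlgebra.mem_supported'.mpr fun g hg => ?_
  simp only [scoredClosure, Set.mem_ofPred_eq, not_forall] at hg
  obtain ⟨σ, hσ, F, hF, hFg⟩ := hg
  obtain ⟨b, hb, hbs⟩ := hs σ hσ F hF
  replace hbs : F (toReal b) = F (toReal s) := hbs
  let N := AddSubmonoid.closure {a | a ∈ A ∧ F (toReal a) = 0}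
  have hN : ∀ n ∈ N, n ∈ semigroup A ∧ F (toReal n) = 0 := by
    intro n hn
    have h1 : N ≤ semigroup A := AddSubmonoid.closure_mono fun a ha => ha.1
    have h2 : N ≤ AddMonoidHom.mker (F.toAddMonoidHom.comp (toRealHom d)) :=
      AddSubmonoid.closure_le.mpr fun a ha => ha.2
    exact ⟨h1 hn, h2 hn⟩
  obtain ⟨m, hm, hms⟩ := (hσ.zerosSpan hA hF).exists_smul_mem_closure (v := s - b)
    (by rw [toReal_sub, map_sub, hbs, sub_self])
  -- At `b + n` the target exponent `g - s + b + n` has `F`-value `F(g)`, so it is outside `ℕA` and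
  -- the coefficient is zero.
  have h := (hk.isPolyFn_coeff hA (g - s)).eq_zero_of_smul_mem_closure (N := N) (b := b)
    (fun n hn => by
      have h1 := hQA (AddMonoidAlgebra.single (b + n) 1)
        (by
          rw [AddMonoidAlgebra.supported_eq_span_single]
          exact Submodule.subset_span ⟨b + n, add_mem hb (hN n hn).1, rfl⟩)
      refine AddMonoidAlgebra.mem_supported'.mp h1 _ fun h2 => hFg ⟨_, h2, ?_⟩
      simp only [toReal_add, toReal_sub, map_add, map_sub, (hN n hn).2, hbs]
      ring) hm
    (AddSubgroup.closure_mono AddSubmonoid.subset_closure hms)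
  simpa using h

/-- The annihilator of the quotient of the span of the monomials with exponents in the scored
closure by `ℂ[ℕA]`. -/
noncomputable def scoredIdeal (A : Finset (Fin d → ℤ)) (hA : AddSubgroup.closure (A : Set (Fin d → ℤ)) = ⊤) :
    TwoSidedIdeal (diffOpRing A) :=
  TwoSidedIdeal.mk'
    {P | ∃ Q ∈ diffOps ℂ (SemigroupRing A) (LaurentRing d),
      (∀ x, Q (algebraMap _ _ x) = algebraMap _ _ (P.1 x)) ∧
        ∀ y ∈ AddMonoidAlgebra.supported ℂ ℂ (scoredClosure A),
          Q y ∈ AddMonoidAlgebra.supported ℂ ℂ (semigroup A : Set (Fin d → ℤ))}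
    ⟨0, zero_mem _, fun x => by simp, fun y _ => zero_mem _⟩
    (by
      rintro P P' ⟨Q, hQ, hQP, hQs⟩ ⟨Q', hQ', hQP', hQs'⟩
      exact ⟨Q + Q', add_mem hQ hQ', fun x => by simp [hQP, hQP'],
        fun y hy => add_mem (hQs y hy) (hQs' y hy)⟩)
    (by
      rintro P ⟨Q, hQ, hQP, hQs⟩
      exact ⟨-Q, neg_mem hQ, fun x => by simp [hQP], fun y hy => neg_mem (hQs y hy)⟩)
    (by
      rintro P P' ⟨Q', hQ', hQP', hQs'⟩
      obtain ⟨k, hk⟩ := P.2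
      obtain ⟨Q, hQ, hQP⟩ := hk.exists_extension (L := LaurentRing d)
        algebraMap_laurent_injective (exists_unit_smul_eq_algebraMap hA)
      refine ⟨Q * Q', mul_mem ⟨k, hQ⟩ hQ', fun x => by simp [hQP, hQP'], fun y hy => ?_⟩
      have h := hQs' y hy
      rw [← SetLike.mem_coe, ← range_algebraMap_laurent] at h ⊢
      obtain ⟨x, hx⟩ := h
      exact ⟨P.1 x, by rw [Module.End.mul_apply, ← hx, hQP]⟩)
    (by
      rintro P P' ⟨Q, hQ, hQP, hQs⟩
      obtain ⟨k, hk⟩ := P'.2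
      obtain ⟨Q', hQ', hQP'⟩ := hk.exists_extension (L := LaurentRing d)
        algebraMap_laurent_injective (exists_unit_smul_eq_algebraMap hA)
      refine ⟨Q * Q', mul_mem hQ ⟨k, hQ'⟩, fun x => by simp [hQP, hQP'], fun y hy => ?_⟩
      -- Closure under right multiplication is where preservation of `ℂ[S_c]` is needed.
      refine hQs _ (map_supported_scoredClosure hA ⟨k, hQ'⟩ (fun z hz => ?_) hy)
      rw [← SetLike.mem_coe, ← range_algebraMap_laurent] at hz ⊢
      obtain ⟨x, rfl⟩ := hz
      exact ⟨P'.1 x, (hQP' x).symm⟩)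

theorem mem_scoredIdeal_iff {hA : AddSubgroup.closure (A : Set (Fin d → ℤ)) = ⊤}
    {P : diffOpRing A} : P ∈ scoredIdeal A hA ↔
      ∃ Q ∈ diffOps ℂ (SemigroupRing A) (LaurentRing d),
        (∀ x, Q (algebraMap _ _ x) = algebraMap _ _ (P.1 x)) ∧
          ∀ y ∈ AddMonoidAlgebra.supported ℂ ℂ (scoredClosure A),
            Q y ∈ AddMonoidAlgebra.supported ℂ ℂ (semigroup A : Set (Fin d → ℤ)) :=
  TwoSidedIdeal.mem_mk' _ _ _ _ _ _ _

/-- Multiplication by the monomial of a conductor lies in the ideal. -/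
theorem scoredIdeal_ne_bot (hA : AddSubgroup.closure (A : Set (Fin d → ℤ)) = ⊤) :
    scoredIdeal A hA ≠ ⊥ := by
  obtain ⟨c, hc, hcA⟩ := exists_conductor hA
  let r : SemigroupRing A := AddMonoidAlgebra.single ⟨c, hc⟩ 1
  let P : diffOpRing A := ⟨Algebra.lsmul ℂ ℂ (SemigroupRing A) r, 0, fun f m => by
    simp only [Algebra.lsmul_coe]
    exact smul_comm _ _ _⟩
  have hP : P ∈ scoredIdeal A hA := by
    refine mem_scoredIdeal_iff.mpr ⟨Algebra.lsmul ℂ ℂ (LaurentRing d) r, ⟨0, fun f m => ?_⟩,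
      fun x => ?_, fun y hy => ?_⟩
    · simp only [Algebra.lsmul_coe]
      exact smul_comm _ _ _
    · simp only [P, Algebra.lsmul_coe, smul_eq_mul, map_mul, Algebra.smul_def]
    · suffices h : AddMonoidAlgebra.supported ℂ ℂ (scoredClosure A) ≤
          (AddMonoidAlgebra.supported ℂ ℂ (semigroup A : Set (Fin d → ℤ))).comap
            (Algebra.lsmul ℂ ℂ (LaurentRing d) r) from h hy
      rw [AddMonoidAlgebra.supported_eq_span_single, AddMonoidAlgebra.supported_eq_span_single,
        Submodule.span_le]
      rintro _ ⟨s, hs, rfl⟩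
      refine Submodule.subset_span ⟨c + s, hcA s (toReal_mem_cone_of_mem_scoredClosure hA hs), ?_⟩
      simp only [Algebra.lsmul_coe, r, single_smul, AddMonoidAlgebra.single_mul_single, one_mul]
  intro h
  rw [h, TwoSidedIdeal.mem_bot] at hP
  have h1 : r • (1 : SemigroupRing A) = 0 := LinearMap.congr_fun (congrArg Subtype.val hP) 1
  rw [smul_eq_mul, mul_one] at h1
  exact one_ne_zero (AddMonoidAlgebra.single_eq_zero.mp h1)

theorem scoredClosure_subset_of_scoredIdeal_eq_top
    (hA : AddSubgroup.closure (A : Set (Fin d → ℤ)) = ⊤) (h : scoredIdeal A hA = ⊤) :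
    scoredClosure A ⊆ semigroup A := by
  intro s hs
  have h1 : (1 : diffOpRing A) ∈ scoredIdeal A hA := h ▸ TwoSidedIdeal.mem_top _
  obtain ⟨Q, hQ, hQ1, hQs⟩ := mem_scoredIdeal_iff.mp h1
  -- Uniqueness of extensions makes `Q` the identity, so the monomial of `s` itself must lie in
  -- `ℂ[ℕA]`.
  have hQ' : Q = 1 := diffOps_eq_of_forall_algebraMap (exists_unit_smul_eq_algebraMap hA) hQ
    (one_mem _) fun x => by rw [hQ1]; rfl
  subst hQ'
  by_contra hsA
  have h2 := AddMonoidAlgebra.mem_supported'.mp (hQs (AddMonoidAlgebra.single s 1) (by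
    rw [AddMonoidAlgebra.supported_eq_span_single]
    exact Submodule.subset_span ⟨s, hs, rfl⟩)) s hsA
  simp at h2

end Scored

end ToricDiffOp

theorem mainTheorem7 {d : ℕ} (A : Finset (Fin d → ℤ))
    (hA : AddSubgroup.closure (A : Set (Fin d → ℤ)) = ⊤)
    (hsimple : IsSimpleRing (ToricDiffOp.diffOpRing A)) :
    ToricDiffOp.IsScored A := by
  have h := (eq_bot_or_eq_top (ToricDiffOp.scoredIdeal A hA)).resolve_left
    (ToricDiffOp.scoredIdeal_ne_bot hA)
  exact Set.Subset.antisymm ToricDiffOp.semigroup_subset_scoredClosure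
    (ToricDiffOp.scoredClosure_subset_of_scoredIdeal_eq_top hA h)
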